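/- For $n\ge 0$ let $L_n$ be the linear hexagonal chain with $n$ hexagons: the graph with vertices $p_0,\dots,p_n$, $q_0,\dots,q_n$, $u_0,\dots,u_{n-1}$, $v_0,\dots,v_{n-1}$ whose edges are $p_iq_i$ $(0\le i\le n)$ and $p_iu_i$, $u_ip_{i+1}$, $q_iv_i$, $v_iq_{i+1}$ $(0\le i\le n-1)$. Let $r_{L_n}(a,b)$ be the resistance distance (effective resistance) between the vertices $a$ and $b$ of $L_n$ when every edge is a unit resistor, that is, $r_{L_n}(a,b)=f(a)-f(b)$ for any real function $f$ on the vertices such that $\sum_{y\sim x}(f(x)-f(y))=\mathbf 1_{x=a}-\mathbf 1_{x=b}$ for every vertex $x$. Put $\alpha=3-2\sqrt2$. Then: (i) For all fixed integers $i\ge j\ge 0$, $$\lim_{n\to\infty}r_{L_n}(p_i,p_j)=\lim_{n\to\infty}r_{L_n}(p_j,p_i)=i-j+\frac{(1-\alpha^{i-j})(2-\alpha^{i+j+1}+\alpha^{2j+1})}{4\sqrt2},$$ $$\lim_{n\to\infty}r_{L_n}(q_i,p_j)=\lim_{n\to\infty}r_{L_n}(q_j,p_i)=i-j+\frac{(1+\alpha^{i-j})(2+\alpha^{i+j+1}+\alpha^{2j+1})}{4\sqrt2}.$$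 (ii) $\displaystyle\lim_{n\to\infty}\frac1n\,r_{L_n}(p_n,p_0)=\lim_{n\to\infty}\frac1n\,r_{L_n}(q_n,p_0)=1.$ (iii) $\displaystyle\lim_{n\to\infty}\bigl[r_{L_{n+1}}(p_{n+1},p_0)-r_{L_n}(p_n,p_0)\bigr]=\lim_{n\to\infty}\bigl[r_{L_{n+1}}(q_{n+1},p_0)-r_{L_n}(q_n,p_0)\bigr]=1.$ (iv) $\displaystyle\lim_{n\to\infty}r_{L_n}\bigl(p_{\lfloor (n-1)/2\rfloor+1},p_{\lfloor (n-1)/2\rfloor}\bigr)=2-\frac{\sqrt2}2$ and $\displaystyle\lim_{n\to\infty}r_{L_n}\bigl(p_{\lfloor n/2\rfloor},q_{\lfloor n/2\rfloor}\bigr)=\frac{\sqrt2}2.$ -/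

import Mathlib

open Filter Topology

/-- `f` is an electric potential on the finite graph `G`, all of whose edges are unit resistors,
when a unit current enters at `a` and leaves at `b`: by Ohm's law the current from `x` to a
neighbour `y` is `f x - f y`, and by Kirchhoff's current law the net current out of each vertex
`x` equals the external current injected at `x`. -/
def IsUnitCurrentPotential {V : Type*} [Fintype V] (G : SimpleGraph V) (a b : V)
    (f : V → ℝ) : Prop :=
  open Classical in
  ∀ x : V, (∑ y ∈ G.neighborFinset x, (f x - f y)) =
    (if x = a then 1 else 0) - (if x = b then 1 else 0)

/-- The potential difference between `a` and `b` does not depend on the potential chosen. -/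
theorem IsUnitCurrentPotential.sub_eq_sub {V : Type*} [Fintype V] {G : SimpleGraph V} {a b : V}
    {f g : V → ℝ} (hf : IsUnitCurrentPotential G a b f) (hg : IsUnitCurrentPotential G a b g) :
    f a - f b = g a - g b := by
  classical
  have key : ∀ h k : V → ℝ, (∑ x, k x * ∑ y ∈ G.neighborFinset x, (h x - h y)) =
      ∑ x, h x * ∑ y ∈ G.neighborFinset x, (k x - k y) := by
    intro h k
    have e : ∀ h k : V → ℝ, (∑ x, k x * ∑ y ∈ G.neighborFinset x, (h x - h y)) =
        (∑ x, ∑ y, if G.Adj x y then k x * h x else 0) -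
          ∑ x, ∑ y, if G.Adj x y then k x * h y else 0 := by
      intro h k
      rw [← Finset.sum_sub_distrib]
      refine Finset.sum_congr rfl fun x _ => ?_
      rw [← Finset.sum_sub_distrib, Finset.mul_sum, SimpleGraph.neighborFinset_eq_filter,
        Finset.sum_filter]
      refine Finset.sum_congr rfl fun y _ => ?_
      split_ifs <;> ring
    rw [e h k, e k h]
    congr 1
    · simp only [mul_comm]
    · rw [Finset.sum_comm]
      simp only [mul_comm, SimpleGraph.adj_comm]
  have hval : ∀ h k : V → ℝ, IsUnitCurrentPotential G a b h →
      (∑ x, k x * ∑ y ∈ G.neighborFinset x, (h x - h y)) = k a - k b := by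
    intro h k hh
    have hh' : ∀ x : V, (∑ y ∈ G.neighborFinset x, (h x - h y)) =
        (if x = a then 1 else 0) - (if x = b then 1 else 0) := by
      intro x
      convert hh x
    simp only [hh', mul_sub, Finset.sum_sub_distrib]
    simp
  rw [← hval g f hg, ← hval f g hf, key]

open Classical in
/-- The resistance distance (effective resistance) `r_G(a, b)` of a finite graph with unit
resistors: the potential difference between `a` and `b` when a unit current flows from `a` to
`b`. A potential exists whenever `a` and `b` are connected in `G`; otherwise the value is a dummy
value `0`. -/
noncomputable def resistanceDist {V : Type*} [Fintype V] (G : SimpleGraph V) (a b : V) : ℝ :=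
  if h : ∃ f : V → ℝ, IsUnitCurrentPotential G a b f then h.choose a - h.choose b else 0

theorem IsUnitCurrentPotential.resistanceDist_eq {V : Type*} [Fintype V] {G : SimpleGraph V}
    {a b : V} {f : V → ℝ} (hf : IsUnitCurrentPotential G a b f) :
    resistanceDist G a b = f a - f b := by
  have h : ∃ f : V → ℝ, IsUnitCurrentPotential G a b f := ⟨f, hf⟩
  rw [resistanceDist, dif_pos h]
  exact h.choose_spec.sub_eq_sub hf

/-- The `4 n + 2` vertices of the linear hexagonal chain with `n` hexagons:
`p_0, …, p_n`, `q_0, …, q_n`, `u_0, …, u_{n-1}`, `v_0, …, v_{n-1}`. -/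
inductive HexVertex (n : ℕ) : Type
  | p (i : Fin (n + 1))
  | q (i : Fin (n + 1))
  | u (i : Fin n)
  | v (i : Fin n)
  deriving DecidableEq, Fintype

/-- The edges of the linear hexagonal chain, each listed in one orientation:
`p_i q_i` for `0 ≤ i ≤ n`, and `p_i u_i`, `p_{i+1} u_i`, `q_i v_i`, `q_{i+1} v_i` for
`0 ≤ i < n`. -/
def hexEdge {n : ℕ} : HexVertex n → HexVertex n → Prop
  | .p i, .q j => i = j
  | .p i, .u k => i = k.castSucc ∨ i = k.succ
  | .q i, .v k => i = k.castSucc ∨ i = k.succ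
  | _, _ => False

/-- The linear hexagonal chain `L_n`, whose `i`-th hexagon (`1 ≤ i ≤ n`) is the cycle
`p_{i-1}, u_{i-1}, p_i, q_i, v_{i-1}, q_{i-1}`. -/
def hexChain (n : ℕ) : SimpleGraph (HexVertex n) := SimpleGraph.fromRel hexEdge

/-- The vertex `p_i` of `L_n`, for `i ≤ n`
(for `i > n`, where there is no such vertex, the index is reduced modulo `n + 1`). -/
def hexP (n i : ℕ) : HexVertex n := .p (Fin.ofNat (n + 1) i)

/-- The vertex `q_i` of `L_n`, for `i ≤ n`
(for `i > n`, where there is no such vertex, the index is reduced modulo `n + 1`). -/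
def hexQ (n i : ℕ) : HexVertex n := .q (Fin.ofNat (n + 1) i)

/-- The resistance distance `r_{L_n}(a, b)`. -/
noncomputable def hexRes (n : ℕ) (a b : HexVertex n) : ℝ := resistanceDist (hexChain n) a b

/-- The constant `α = 3 - 2 √2`. -/
noncomputable def hexAlpha : ℝ := 3 - 2 * √2

/-! The reflection exchanging `p_i` and `q_i` (and `u_i` and `v_i`) splits a potential on `L_n`
into a symmetric and an antisymmetric part. Since a hexagon side through `u_i` or `v_i` acts as a
resistor of two units, both parts are functions of the rung number `k` alone.

* The symmetric part sees only a path of resistors. It is `min k a - min k b` for a source at rung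
  `a` and a sink at rung `b`, and contributes `|a - b|` to the resistance.
* The antisymmetric part `d` satisfies `6 * d k - d (k + 1) - d (k - 1) = ± δ`, with reflecting
  ends. The roots of the characteristic equation `x ^ 2 = 6 * x - 1` are `α` and `α⁻¹`, so its
  Green function `hexGreen` is the product of the two solutions adapted to the left and the right
  end, divided by their Wronskian (`hexGreen_eq`, `hexGreen_closed_form`).

Writing `G` for the Green function, `r(p_a, p_b) = |a - b| + G a a - 2 * G a b + G b b`, and
`r(q_a, p_b)` is the same with the sign of the middle term changed (`hexRes_p_p`, `hexRes_q_p`).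
In the closed form `G i j` is `α ^ (i - j) / (4 * √2)` times a factor `1 + α ^ (2 * j + 1)` for
the left end and a factor `1 + α ^ (2 * (n - i) + 1)` for the right end, up to a normalisation that
tends to `1`. All the limits follow from `0 < α < 1`: fixed indices lose the right factor, middle
indices lose both, and between opposite ends `G` stays bounded while `|a - b| = n`. -/

/-! ### Kirchhoff's law on the hexagonal chain -/

/-- Vertices of `L_n` split into the four families `p`, `q`, `u`, `v`. -/
def hexVertexEquiv (n : ℕ) :
    HexVertex n ≃ (Fin (n + 1) ⊕ Fin (n + 1)) ⊕ (Fin n ⊕ Fin n) where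
  toFun
    | .p i => .inl (.inl i)
    | .q i => .inl (.inr i)
    | .u i => .inr (.inl i)
    | .v i => .inr (.inr i)
  invFun
    | .inl (.inl i) => .p i
    | .inl (.inr i) => .q i
    | .inr (.inl i) => .u i
    | .inr (.inr i) => .v i
  left_inv x := by cases x <;> rfl
  right_inv x := by rcases x with (i | i) | (i | i) <;> rfl

theorem HexVertex.sum_eq {n : ℕ} (F : HexVertex n → ℝ) :
    ∑ x, F x = (∑ i, F (.p i) + ∑ i, F (.q i)) + (∑ i, F (.u i) + ∑ i, F (.v i)) := by
  rw [← (hexVertexEquiv n).symm.sum_comp F]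
  simp only [Fintype.sum_sum_type]
  rfl

theorem hexChain_adj {n : ℕ} (x y : HexVertex n) :
    (hexChain n).Adj x y ↔ hexEdge x y ∨ hexEdge y x := by
  rw [hexChain, SimpleGraph.fromRel_adj, and_iff_right_iff_imp]
  rintro h rfl
  cases x <;> simp [hexEdge] at h

/-- A sum over the hexagons `k` that end or begin at the rung `i`, with the values of a function
`P` on rungs: the missing hexagon at either end of the chain does not contribute, because
`P (n + 1) = P n` and because `i - 1 = i` for `i = 0` in `ℕ`. -/
theorem sum_adjacent_hexagons {n : ℕ} (P : ℕ → ℝ) (hP : P (n + 1) = P n) (i : Fin (n + 1)) :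
    (∑ k : Fin n, if i = k.castSucc ∨ i = k.succ then P i - (P k + P (k + 1)) / 2 else 0) =
      (P i - P (i + 1)) / 2 + (P i - P (i - 1)) / 2 := by
  have hsplit : ∀ k : Fin n,
      (if i = k.castSucc ∨ i = k.succ then P i - (P k + P (k + 1)) / 2 else 0) =
        (if i = k.castSucc then (P i - P (i + 1)) / 2 else 0) +
          (if i = k.succ then (P i - P (i - 1)) / 2 else 0) := by
    intro k
    by_cases h₁ : i = k.castSucc
    · have h₂ : i ≠ k.succ := by
        rintro rfl
        simp [Fin.ext_iff] at h₁
      rw [if_pos (Or.inl h₁), if_pos h₁, if_neg h₂, h₁, Fin.val_castSucc]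
      ring
    · by_cases h₂ : i = k.succ
      · rw [if_pos (Or.inr h₂), if_neg h₁, if_pos h₂, h₂, Fin.val_succ, Nat.add_sub_cancel]
        ring
      · simp [h₁, h₂]
  simp only [hsplit, Finset.sum_add_distrib]
  congr 1
  · rcases Fin.eq_castSucc_or_eq_last i with ⟨k, rfl⟩ | rfl
    · simp
    · simp [hP, Fin.ext_iff, (Fin.is_lt _).ne']
  · rcases Fin.eq_zero_or_eq_succ i with rfl | ⟨k, rfl⟩
    · simp [Fin.ext_iff]
    · simp

/-- The function on the vertices of `L_n` with values `P i` at `p_i` and `Q i` at `q_i`, and the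
mean of the values at the two neighbours at each `u_i` and `v_i`. -/
noncomputable def hexExtend (n : ℕ) (P Q : ℕ → ℝ) : HexVertex n → ℝ
  | .p i => P i
  | .q i => Q i
  | .u k => (P k + P (k + 1)) / 2
  | .v k => (Q k + Q (k + 1)) / 2

/-- Kirchhoff's law for `hexExtend n P Q` need only be checked at the vertices `p_i` and `q_i`.
There each hexagon acts as a resistor of two units between consecutive rungs; under the
convention `P (n + 1) = P n` and `0 - 1 = 0` the two ends of the chain need no special form. -/
theorem isUnitCurrentPotential_hexExtend {n : ℕ} {P Q : ℕ → ℝ} {a b : HexVertex n}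
    (hP : P (n + 1) = P n) (hQ : Q (n + 1) = Q n)
    (hp : ∀ i : Fin (n + 1),
      P i - Q i + ((P i - P (i + 1)) / 2 + (P i - P (i - 1)) / 2) =
        (if .p i = a then 1 else 0) - (if .p i = b then 1 else 0))
    (hq : ∀ i : Fin (n + 1),
      Q i - P i + ((Q i - Q (i + 1)) / 2 + (Q i - Q (i - 1)) / 2) =
        (if .q i = a then 1 else 0) - (if .q i = b then 1 else 0))
    (hau : ∀ k, a ≠ .u k) (hav : ∀ k, a ≠ .v k) (hbu : ∀ k, b ≠ .u k) (hbv : ∀ k, b ≠ .v k) :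
    IsUnitCurrentPotential (hexChain n) a b (hexExtend n P Q) := by
  classical
  have hends : ∀ (k : Fin n) (F : Fin (n + 1) → ℝ),
      (∑ i, if i = k.castSucc ∨ i = k.succ then F i else 0) = F k.castSucc + F k.succ := by
    intro k F
    have hne : k.castSucc ≠ k.succ := by simp [Fin.ext_iff]
    rw [← Finset.sum_filter, ← Finset.sum_pair hne]
    congr 1
    ext i
    simp
  intro x
  rw [SimpleGraph.neighborFinset_eq_filter, Finset.sum_filter, HexVertex.sum_eq]
  cases x with
  | p i =>
    simp only [hexChain_adj, hexEdge, hexExtend, or_false, if_false,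
      Finset.sum_const_zero, zero_add, add_zero, Finset.sum_ite_eq, Finset.mem_univ, if_true,
      sum_adjacent_hexagons P hP]
    convert hp i
  | q i =>
    simp only [hexChain_adj, hexEdge, hexExtend, false_or, or_false, if_false,
      Finset.sum_const_zero, zero_add, add_zero, Finset.sum_ite_eq', Finset.mem_univ, if_true,
      sum_adjacent_hexagons Q hQ]
    convert hq i
  | u k =>
    rw [if_neg (hau k).symm, if_neg (hbu k).symm]
    simp only [hexChain_adj, hexEdge, hexExtend, false_or, or_false, if_false,
      Finset.sum_const_zero, add_zero, hends, Fin.val_castSucc, Fin.val_succ]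
    ring
  | v k =>
    rw [if_neg (hav k).symm, if_neg (hbv k).symm]
    simp only [hexChain_adj, hexEdge, hexExtend, false_or, or_false, if_false,
      Finset.sum_const_zero, zero_add, add_zero, hends, Fin.val_castSucc, Fin.val_succ]
    ring

theorem resistanceDist_comm {V : Type*} [Fintype V] (G : SimpleGraph V) (a b : V) :
    resistanceDist G a b = resistanceDist G b a := by
  have hneg : ∀ {a b : V} {f : V → ℝ}, IsUnitCurrentPotential G a b f →
      IsUnitCurrentPotential G b a (-f) := by
    intro a b f hf x
    rw [← neg_sub, ← hf x, ← Finset.sum_neg_distrib]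
    refine Finset.sum_congr rfl fun y _ => ?_
    simp only [Pi.neg_apply]
    ring
  by_cases h : ∃ f, IsUnitCurrentPotential G a b f
  · obtain ⟨f, hf⟩ := h
    rw [hf.resistanceDist_eq, (hneg hf).resistanceDist_eq]
    simp only [Pi.neg_apply]
    ring
  · have h' : ¬ ∃ f, IsUnitCurrentPotential G b a f := fun ⟨f, hf⟩ => h ⟨-f, hneg hf⟩
    rw [resistanceDist, resistanceDist, dif_neg h, dif_neg h']

/-! ### The constant `α` -/

theorem hexAlpha_sq : hexAlpha ^ 2 = 6 * hexAlpha - 1 := by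
  have h : √2 ^ 2 = 2 := Real.sq_sqrt (by norm_num)
  rw [hexAlpha]
  linear_combination 4 * h

theorem hexAlpha_pos : 0 < hexAlpha := by
  have h : √2 < 3 / 2 := by
    rw [Real.sqrt_lt' (by norm_num)]
    norm_num
  rw [hexAlpha]
  linarith

theorem hexAlpha_lt_one : hexAlpha < 1 := by
  have h : 1 < √2 := Real.one_lt_sqrt_two
  rw [hexAlpha]
  linarith

/-- Both roots of `x ^ 2 = 6 * x - 1` occur: the other one is `α⁻¹ = 3 + 2 √2`. -/
theorem inv_hexAlpha : hexAlpha⁻¹ = 6 - hexAlpha := by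
  rw [inv_eq_iff_eq_inv, ← one_div, eq_div_iff (by linarith [hexAlpha_lt_one])]
  linear_combination -hexAlpha_sq

theorem inv_hexAlpha_sub : hexAlpha⁻¹ - hexAlpha = 4 * √2 := by
  rw [inv_hexAlpha, hexAlpha]
  ring

theorem inv_hexAlpha_sq : hexAlpha⁻¹ ^ 2 = 6 * hexAlpha⁻¹ - 1 := by
  rw [inv_hexAlpha]
  linear_combination hexAlpha_sq

theorem hexAlpha_pow_mul_inv_pow (k : ℕ) : hexAlpha ^ k * hexAlpha⁻¹ ^ k = 1 := by
  rw [← mul_pow, mul_inv_cancel₀ hexAlpha_pos.ne', one_pow]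

theorem tendsto_hexAlpha_pow {e : ℕ → ℕ} (he : Tendsto e atTop atTop) :
    Tendsto (fun n => hexAlpha ^ e n) atTop (𝓝 0) :=
  (tendsto_pow_atTop_nhds_zero_of_lt_one hexAlpha_pos.le hexAlpha_lt_one).comp he

/-! ### The Green function of the antisymmetric part -/

/-- The solution of `A (k + 2) = 6 * A (k + 1) - A k` with no current through the left end, that
is, with `A 1 = 5 * A 0`. -/
noncomputable def hexLeft (k : ℕ) : ℝ := hexAlpha⁻¹ ^ k + hexAlpha ^ (k + 1)

/-- The solution of `B (k + 2) = 6 * B (k + 1) - B k` with no current through the right end, that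
is, with `B (n + 1) = B n`. -/
noncomputable def hexRight (n k : ℕ) : ℝ :=
  hexAlpha ^ k + hexAlpha ^ (2 * n + 1) * hexAlpha⁻¹ ^ k

/-- The Wronskian of `hexLeft` and `hexRight n`. -/
noncomputable def hexWronskian (n : ℕ) : ℝ := 4 * √2 * (1 - hexAlpha ^ (2 * n + 2))

/-- The Green function of the operator `h ↦ 6 * h k - h (k + 1) - h (k - 1)` on `{0, …, n}` with
reflecting ends. -/
noncomputable def hexGreen (n i j : ℕ) : ℝ :=
  hexLeft (min i j) * hexRight n (max i j) / hexWronskian n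

theorem hexLeft_rec (k : ℕ) : hexLeft (k + 2) = 6 * hexLeft (k + 1) - hexLeft k := by
  simp only [hexLeft, pow_succ _ (k + 1), pow_succ _ (k + 2), pow_succ _ k]
  linear_combination hexAlpha⁻¹ ^ k * inv_hexAlpha_sq + hexAlpha ^ k * hexAlpha * hexAlpha_sq

theorem hexRight_rec (n k : ℕ) : hexRight n (k + 2) = 6 * hexRight n (k + 1) - hexRight n k := by
  simp only [hexRight, pow_succ _ (k + 1), pow_succ _ k]
  linear_combination hexAlpha ^ k * hexAlpha_sq +
    hexAlpha ^ (2 * n + 1) * hexAlpha⁻¹ ^ k * inv_hexAlpha_sq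

theorem hexLeft_one : hexLeft 1 = 5 * hexLeft 0 := by
  simp only [hexLeft, inv_hexAlpha]
  linear_combination hexAlpha_sq

theorem hexRight_succ_self (n : ℕ) : hexRight n (n + 1) = hexRight n n := by
  have h := hexAlpha_pow_mul_inv_pow n
  have h₁ := mul_inv_cancel₀ hexAlpha_pos.ne'
  have e : hexAlpha ^ (2 * n + 1) = hexAlpha ^ n * hexAlpha ^ n * hexAlpha := by ring
  simp only [hexRight, e, pow_succ _ n]
  linear_combination (hexAlpha ^ n * hexAlpha * hexAlpha⁻¹ - hexAlpha ^ n * hexAlpha) * h +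
    hexAlpha ^ n * h₁

theorem hexWronskian_eq (n k : ℕ) :
    hexLeft (k + 1) * hexRight n k - hexLeft k * hexRight n (k + 1) = hexWronskian n := by
  have h := hexAlpha_pow_mul_inv_pow k
  have e : hexAlpha ^ (2 * n + 2) = hexAlpha ^ (2 * n + 1) * hexAlpha := by ring
  rw [hexWronskian, ← inv_hexAlpha_sub, e]
  simp only [hexLeft, hexRight, pow_succ _ k, pow_succ _ (k + 1)]
  generalize hexAlpha ^ (2 * n + 1) = c
  linear_combination (hexAlpha⁻¹ - hexAlpha + c * hexAlpha ^ 2 - c * (hexAlpha * hexAlpha⁻¹)) * h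

theorem hexWronskian_pos (n : ℕ) : 0 < hexWronskian n := by
  have h : hexAlpha ^ (2 * n + 2) < 1 :=
    pow_lt_one₀ hexAlpha_pos.le hexAlpha_lt_one (by omega)
  have h₂ : 0 < √2 := by positivity
  rw [hexWronskian]
  exact mul_pos (by positivity) (by linarith)

theorem hexGreen_comm (n i j : ℕ) : hexGreen n i j = hexGreen n j i := by
  rw [hexGreen, hexGreen, min_comm, max_comm]

theorem hexGreen_of_le (n : ℕ) {i j : ℕ} (h : j ≤ i) :
    hexGreen n i j = hexLeft j * hexRight n i / hexWronskian n := by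
  rw [hexGreen, min_eq_right h, max_eq_left h]

theorem hexGreen_of_ge (n : ℕ) {i j : ℕ} (h : i ≤ j) :
    hexGreen n i j = hexLeft i * hexRight n j / hexWronskian n := by
  rw [hexGreen_comm, hexGreen_of_le n h]

theorem hexGreen_succ_self {n a : ℕ} (ha : a ≤ n) : hexGreen n (n + 1) a = hexGreen n n a := by
  rw [hexGreen_of_le n (by omega), hexGreen_of_le n ha, hexRight_succ_self]

theorem hexGreen_eq (n k a : ℕ) :
    6 * hexGreen n k a - hexGreen n (k + 1) a - hexGreen n (k - 1) a =
      if k = a then 1 else 0 := by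
  have hW := (hexWronskian_pos n).ne'
  rcases lt_trichotomy k a with h | rfl | h
  · rw [if_neg h.ne, hexGreen_of_ge n h.le, hexGreen_of_ge n (by omega : k + 1 ≤ a),
      hexGreen_of_ge n (by omega : k - 1 ≤ a)]
    rcases k with _ | k
    · rw [zero_add, hexLeft_one]
      ring
    · rw [hexLeft_rec, Nat.add_sub_cancel]
      ring
  · rw [if_pos rfl, hexGreen_of_ge n le_rfl, hexGreen_of_le n (by omega : k ≤ k + 1),
      hexGreen_of_ge n (by omega : k - 1 ≤ k), ← sub_eq_zero]
    field_simp
    rw [← hexWronskian_eq n k]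
    rcases k with _ | k
    · rw [zero_add, hexLeft_one]
      ring
    · rw [hexLeft_rec, Nat.add_sub_cancel]
      ring
  · obtain ⟨k, rfl⟩ : ∃ m, k = m + 1 := ⟨k - 1, by omega⟩
    rw [if_neg h.ne', hexGreen_of_le n h.le, hexGreen_of_le n (by omega : a ≤ k + 1 + 1),
      Nat.add_sub_cancel, hexGreen_of_le n (by omega : a ≤ k), hexRight_rec]
    ring

/-- The closed form of the Green function, whose factors are a decay between `i` and `j` and a
reflection at each end of the chain. -/
theorem hexGreen_closed_form {n i j : ℕ} (hj : j ≤ i) (hi : i ≤ n) :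
    hexGreen n i j = hexAlpha ^ (i - j) * (1 + hexAlpha ^ (2 * j + 1)) *
      (1 + hexAlpha ^ (2 * (n - i) + 1)) / (4 * √2 * (1 - hexAlpha ^ (2 * n + 2))) := by
  obtain ⟨m, rfl⟩ := Nat.exists_eq_add_of_le hj
  obtain ⟨l, rfl⟩ := Nat.exists_eq_add_of_le hi
  have hl : hexLeft j = hexAlpha⁻¹ ^ j * (1 + hexAlpha ^ (2 * j + 1)) := by
    rw [hexLeft]
    linear_combination (-hexAlpha ^ (j + 1)) * hexAlpha_pow_mul_inv_pow j
  have hr : hexRight (j + m + l) (j + m) =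
      hexAlpha ^ (j + m) * (1 + hexAlpha ^ (2 * l + 1)) := by
    have e : hexAlpha ^ (2 * (j + m + l) + 1) =
        hexAlpha ^ (j + m) * hexAlpha ^ (j + m) * hexAlpha ^ (2 * l + 1) := by ring
    rw [hexRight, e]
    linear_combination (hexAlpha ^ (j + m) * hexAlpha ^ (2 * l + 1)) *
      hexAlpha_pow_mul_inv_pow (j + m)
  rw [hexGreen_of_le _ hj, hexWronskian, hl, hr, Nat.add_sub_cancel_left, Nat.add_sub_cancel_left]
  congr 1
  linear_combination (hexAlpha ^ m * (1 + hexAlpha ^ (2 * j + 1)) *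
    (1 + hexAlpha ^ (2 * l + 1))) * hexAlpha_pow_mul_inv_pow j

theorem tendsto_hexGreen {i j : ℕ → ℕ} {x y z : ℝ} (hij : ∀ᶠ n in atTop, j n ≤ i n ∧ i n ≤ n)
    (hx : Tendsto (fun n => hexAlpha ^ (i n - j n)) atTop (𝓝 x))
    (hy : Tendsto (fun n => hexAlpha ^ (2 * j n + 1)) atTop (𝓝 y))
    (hz : Tendsto (fun n => hexAlpha ^ (2 * (n - i n) + 1)) atTop (𝓝 z)) :
    Tendsto (fun n => hexGreen n (i n) (j n)) atTop
      (𝓝 (x * (1 + y) * (1 + z) / (4 * √2))) := by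
  have hW : Tendsto (fun n : ℕ => 4 * √2 * (1 - hexAlpha ^ (2 * n + 2))) atTop
      (𝓝 (4 * √2 * (1 - 0))) :=
    ((tendsto_hexAlpha_pow (tendsto_atTop_mono (fun n => by dsimp only [id]; omega) tendsto_id)).const_sub
      1).const_mul _
  rw [sub_zero, mul_one] at hW
  refine Tendsto.congr' ?_
    (((hx.mul (hy.const_add 1)).mul (hz.const_add 1)).div hW (by positivity))
  filter_upwards [hij] with n hn
  exact (hexGreen_closed_form hn.1 hn.2).symm

/-! ### Resistance distances in the finite chain -/

/-- The symmetric part of the potential: a source at rung `a`, with its current leaving at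
rung `0`. -/
theorem min_second_difference (k a : ℕ) :
    2 * (min k a : ℕ) - (min (k + 1) a : ℕ) - (min (k - 1) a : ℕ) =
      (if k = a then 1 else 0) - (if k = 0 then (1 : ℝ) else 0) := by
  rcases lt_trichotomy k a with h | rfl | h
  · rw [min_eq_left h.le, min_eq_left (by omega : k + 1 ≤ a),
      min_eq_left (by omega : k - 1 ≤ a), if_neg h.ne]
    rcases k with _ | k
    · simp
    · simp
      ring
  · rw [min_self, min_eq_right (by omega), min_eq_left (by omega), if_pos rfl]
    rcases k with _ | k
    · simp
    · simp
      ring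
  · rw [min_eq_right h.le, min_eq_right (by omega : a ≤ k + 1),
      min_eq_right (by omega : a ≤ k - 1), if_neg h.ne', if_neg (by omega)]
    ring

theorem val_ofNat_of_le {n i : ℕ} (h : i ≤ n) : (Fin.ofNat (n + 1) i : ℕ) = i := by
  simpa using Nat.mod_eq_of_lt (Nat.lt_succ_of_le h)

theorem hexRes_p_p {n a b : ℕ} (ha : a ≤ n) (hb : b ≤ n) :
    hexRes n (hexP n a) (hexP n b) = (a + b - 2 * (min a b : ℕ) : ℝ) +
      (hexGreen n a a - 2 * hexGreen n a b + hexGreen n b b) := by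
  -- `s` is the symmetric and `d` the antisymmetric part of the potential.
  set s : ℕ → ℝ := fun k => (min k a : ℕ) - (min k b : ℕ) with hs
  set d : ℕ → ℝ := fun k => hexGreen n k a - hexGreen n k b with hd
  have hs' : s (n + 1) = s n := by
    simp only [hs]
    rw [min_eq_right (by omega), min_eq_right (by omega), min_eq_right ha, min_eq_right hb]
  have hd' : d (n + 1) = d n := by
    simp only [hd, hexGreen_succ_self ha, hexGreen_succ_self hb]
  have hf : IsUnitCurrentPotential (hexChain n) (hexP n a) (hexP n b)
      (hexExtend n (fun k => s k + d k) (fun k => s k - d k)) := by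
    refine isUnitCurrentPotential_hexExtend (by simp only [hs', hd']) (by simp only [hs', hd'])
      (fun i => ?_) (fun i => ?_) (by simp [hexP]) (by simp [hexP]) (by simp [hexP])
      (by simp [hexP])
    · simp only [hexP, HexVertex.p.injEq, Fin.ext_iff, val_ofNat_of_le ha, val_ofNat_of_le hb]
      simp only [hs, hd]
      linear_combination (min_second_difference i a - min_second_difference i b +
        hexGreen_eq n i a - hexGreen_eq n i b) / 2
    · simp only [hexP, reduceCtorEq, if_false, hs, hd]
      linear_combination (min_second_difference i a - min_second_difference i b -
        hexGreen_eq n i a + hexGreen_eq n i b) / 2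
  rw [hexRes, hf.resistanceDist_eq]
  simp only [hexP, hexExtend, val_ofNat_of_le ha, val_ofNat_of_le hb, hs, hd, min_self]
  rw [min_comm b a, hexGreen_comm n b a]
  ring

theorem hexRes_q_p {n a b : ℕ} (ha : a ≤ n) (hb : b ≤ n) :
    hexRes n (hexQ n a) (hexP n b) = (a + b - 2 * (min a b : ℕ) : ℝ) +
      (hexGreen n a a + 2 * hexGreen n a b + hexGreen n b b) := by
  -- The source now lies on the `q` side, which changes the sign of its antisymmetric part.
  set s : ℕ → ℝ := fun k => (min k a : ℕ) - (min k b : ℕ) with hs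
  set d : ℕ → ℝ := fun k => -hexGreen n k a - hexGreen n k b with hd
  have hs' : s (n + 1) = s n := by
    simp only [hs]
    rw [min_eq_right (by omega), min_eq_right (by omega), min_eq_right ha, min_eq_right hb]
  have hd' : d (n + 1) = d n := by
    simp only [hd, hexGreen_succ_self ha, hexGreen_succ_self hb]
  have hf : IsUnitCurrentPotential (hexChain n) (hexQ n a) (hexP n b)
      (hexExtend n (fun k => s k + d k) (fun k => s k - d k)) := by
    refine isUnitCurrentPotential_hexExtend (by simp only [hs', hd']) (by simp only [hs', hd'])
      (fun i => ?_) (fun i => ?_) (by simp [hexQ]) (by simp [hexQ]) (by simp [hexP])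
      (by simp [hexP])
    · simp only [hexP, hexQ, HexVertex.p.injEq, reduceCtorEq, if_false, Fin.ext_iff,
        val_ofNat_of_le hb]
      simp only [hs, hd]
      linear_combination (min_second_difference i a - min_second_difference i b -
        hexGreen_eq n i a - hexGreen_eq n i b) / 2
    · simp only [hexP, hexQ, HexVertex.q.injEq, reduceCtorEq, if_false, Fin.ext_iff,
        val_ofNat_of_le ha]
      simp only [hs, hd]
      linear_combination (min_second_difference i a - min_second_difference i b +
        hexGreen_eq n i a + hexGreen_eq n i b) / 2
  rw [hexRes, hf.resistanceDist_eq]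
  simp only [hexP, hexQ, hexExtend, val_ofNat_of_le ha, val_ofNat_of_le hb, hs, hd, min_self]
  rw [min_comm b a, hexGreen_comm n b a]
  ring

theorem hexRes_comm (n : ℕ) (a b : HexVertex n) : hexRes n a b = hexRes n b a :=
  resistanceDist_comm _ a b

/-! ### Limits -/

/-- Far from the right end, only the reflection at the left end survives in the Green function. -/
theorem tendsto_hexGreen_fixed {i j : ℕ} (hj : j ≤ i) :
    Tendsto (fun n => hexGreen n i j) atTop
      (𝓝 (hexAlpha ^ (i - j) * (1 + hexAlpha ^ (2 * j + 1)) / (4 * √2))) := by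
  have hz : Tendsto (fun n : ℕ => hexAlpha ^ (2 * (n - i) + 1)) atTop (𝓝 0) :=
    tendsto_hexAlpha_pow (tendsto_atTop_mono (fun n => by omega) (tendsto_sub_atTop_nat i))
  have h := tendsto_hexGreen (i := fun _ => i) (j := fun _ => j)
    ((eventually_ge_atTop i).mono fun n hn => ⟨hj, hn⟩) tendsto_const_nhds tendsto_const_nhds hz
  simpa using h

/-- In the bulk of the chain neither end is felt. -/
theorem tendsto_hexGreen_bulk {i j : ℕ → ℕ} {m : ℕ} (hj : Tendsto j atTop atTop)
    (hi : Tendsto (fun n => n - i n) atTop atTop)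
    (hij : ∀ᶠ n in atTop, i n = j n + m ∧ i n ≤ n) :
    Tendsto (fun n => hexGreen n (i n) (j n)) atTop (𝓝 (hexAlpha ^ m / (4 * √2))) := by
  have h := tendsto_hexGreen (i := i) (j := j) (x := hexAlpha ^ m) (hij.mono fun n hn => ⟨by omega, hn.2⟩)
    (tendsto_const_nhds.congr' (hij.mono fun n hn => by
      simp only [hn.1, Nat.add_sub_cancel_left]))
    (tendsto_hexAlpha_pow (tendsto_atTop_mono (fun n => by omega) hj))
    (tendsto_hexAlpha_pow (tendsto_atTop_mono (fun n => by omega) hi))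
  simpa using h

theorem tendsto_hexGreen_last_last :
    Tendsto (fun n => hexGreen n n n) atTop (𝓝 ((1 + hexAlpha) / (4 * √2))) := by
  have h := tendsto_hexGreen (i := fun n => n) (j := fun n => n) (x := 1) (z := hexAlpha)
    (Eventually.of_forall fun n => ⟨le_rfl, le_rfl⟩) (by simp)
    (tendsto_hexAlpha_pow (tendsto_atTop_mono (fun n => by dsimp only [id]; omega) tendsto_id)) (by simp)
  simpa using h

theorem tendsto_hexGreen_last_zero :
    Tendsto (fun n => hexGreen n n 0) atTop (𝓝 0) := by
  have h := tendsto_hexGreen (i := fun n => n) (j := fun _ => 0) (z := hexAlpha)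
    (Eventually.of_forall fun n => ⟨n.zero_le, le_rfl⟩)
    (tendsto_hexAlpha_pow (tendsto_atTop_mono (fun n => by dsimp only [id]; omega) tendsto_id))
    tendsto_const_nhds (by simp)
  simpa using h

theorem tendsto_hexRes_p_p {i j : ℕ} (hj : j ≤ i) :
    Tendsto (fun n : ℕ => hexRes n (hexP n i) (hexP n j)) atTop
      (𝓝 ((i : ℝ) - (j : ℝ) + (1 - hexAlpha ^ (i - j)) *
        (2 - hexAlpha ^ (i + j + 1) + hexAlpha ^ (2 * j + 1)) / (4 * √2))) := by
  have h := (((tendsto_hexGreen_fixed (le_refl i)).sub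
    ((tendsto_hexGreen_fixed hj).const_mul 2)).add
      (tendsto_hexGreen_fixed (le_refl j))).const_add ((i : ℝ) - j)
  convert h.congr' ?_ using 2
  · obtain ⟨m, rfl⟩ := Nat.exists_eq_add_of_le hj
    simp only [Nat.add_sub_cancel_left, Nat.sub_self]
    ring
  · filter_upwards [eventually_ge_atTop i] with n hn
    rw [hexRes_p_p hn (hj.trans hn), min_eq_right hj]
    ring

theorem tendsto_hexRes_q_p {i j : ℕ} (hj : j ≤ i) :
    Tendsto (fun n : ℕ => hexRes n (hexQ n i) (hexP n j)) atTop
        (𝓝 ((i : ℝ) - (j : ℝ) + (1 + hexAlpha ^ (i - j)) *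
          (2 + hexAlpha ^ (i + j + 1) + hexAlpha ^ (2 * j + 1)) / (4 * √2))) ∧
      Tendsto (fun n : ℕ => hexRes n (hexQ n j) (hexP n i)) atTop
        (𝓝 ((i : ℝ) - (j : ℝ) + (1 + hexAlpha ^ (i - j)) *
          (2 + hexAlpha ^ (i + j + 1) + hexAlpha ^ (2 * j + 1)) / (4 * √2))) := by
  have h := (((tendsto_hexGreen_fixed (le_refl i)).add
    ((tendsto_hexGreen_fixed hj).const_mul 2)).add
      (tendsto_hexGreen_fixed (le_refl j))).const_add ((i : ℝ) - j)
  have hlim : (i : ℝ) - (j : ℝ) + (1 + hexAlpha ^ (i - j)) *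
      (2 + hexAlpha ^ (i + j + 1) + hexAlpha ^ (2 * j + 1)) / (4 * √2) =
      (i : ℝ) - j + (hexAlpha ^ (i - i) * (1 + hexAlpha ^ (2 * i + 1)) / (4 * √2) +
        2 * (hexAlpha ^ (i - j) * (1 + hexAlpha ^ (2 * j + 1)) / (4 * √2)) +
        hexAlpha ^ (j - j) * (1 + hexAlpha ^ (2 * j + 1)) / (4 * √2)) := by
    obtain ⟨m, rfl⟩ := Nat.exists_eq_add_of_le hj
    simp only [Nat.add_sub_cancel_left, Nat.sub_self]
    ring
  rw [hlim]
  constructor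
  · refine h.congr' ?_
    filter_upwards [eventually_ge_atTop i] with n hn
    rw [hexRes_q_p hn (hj.trans hn), min_eq_right hj]
    ring
  · refine h.congr' ?_
    filter_upwards [eventually_ge_atTop i] with n hn
    rw [hexRes_q_p (hj.trans hn) hn, min_eq_left hj, hexGreen_comm n j i]
    ring

theorem exists_tendsto_hexRes_p_p_sub :
    ∃ c, Tendsto (fun n : ℕ => hexRes n (hexP n n) (hexP n 0) - n) atTop (𝓝 c) := by
  refine ⟨_, ((tendsto_hexGreen_last_last.sub (tendsto_hexGreen_last_zero.const_mul 2)).add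
    (tendsto_hexGreen_fixed (le_refl 0))).congr fun n => ?_⟩
  rw [hexRes_p_p le_rfl n.zero_le, Nat.min_zero]
  push_cast
  ring

theorem exists_tendsto_hexRes_q_p_sub :
    ∃ c, Tendsto (fun n : ℕ => hexRes n (hexQ n n) (hexP n 0) - n) atTop (𝓝 c) := by
  refine ⟨_, ((tendsto_hexGreen_last_last.add (tendsto_hexGreen_last_zero.const_mul 2)).add
    (tendsto_hexGreen_fixed (le_refl 0))).congr fun n => ?_⟩
  rw [hexRes_q_p le_rfl n.zero_le, Nat.min_zero]
  push_cast
  ring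

theorem tendsto_one_div_mul_of_tendsto_sub {r : ℕ → ℝ}
    (h : ∃ c, Tendsto (fun n : ℕ => r n - n) atTop (𝓝 c)) :
    Tendsto (fun n : ℕ => 1 / (n : ℝ) * r n) atTop (𝓝 1) := by
  obtain ⟨c, hc⟩ := h
  have h₁ := (tendsto_one_div_atTop_nhds_zero_nat (𝕜 := ℝ)).mul hc |>.const_add 1
  rw [zero_mul, add_zero] at h₁
  refine h₁.congr' ?_
  filter_upwards [eventually_gt_atTop 0] with n hn
  have : (n : ℝ) ≠ 0 := by exact_mod_cast hn.ne'
  field_simp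
  ring

theorem tendsto_succ_sub_of_tendsto_sub {r : ℕ → ℝ}
    (h : ∃ c, Tendsto (fun n : ℕ => r n - n) atTop (𝓝 c)) :
    Tendsto (fun n : ℕ => r (n + 1) - r n) atTop (𝓝 1) := by
  obtain ⟨c, hc⟩ := h
  have h₁ := ((hc.comp (tendsto_add_atTop_nat 1)).sub hc).const_add 1
  rw [sub_self, add_zero] at h₁
  refine h₁.congr fun n => ?_
  simp only [Function.comp_apply]
  push_cast
  ring

theorem tendsto_hexRes_middle_p_p :
    Tendsto (fun n : ℕ => hexRes n (hexP n ((n - 1) / 2 + 1)) (hexP n ((n - 1) / 2))) atTop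
      (𝓝 (2 - √2 / 2)) := by
  have hl : Tendsto (fun n : ℕ => (n - 1) / 2) atTop atTop :=
    tendsto_atTop_atTop.2 fun b => ⟨2 * b + 1, fun n hn => by omega⟩
  have hl' : Tendsto (fun n : ℕ => (n - 1) / 2 + 1) atTop atTop :=
    tendsto_atTop_mono (fun n => Nat.le_succ _) hl
  have hr' : Tendsto (fun n : ℕ => n - ((n - 1) / 2 + 1)) atTop atTop :=
    tendsto_atTop_atTop.2 fun b => ⟨2 * b + 1, fun n hn => by omega⟩
  have hr : Tendsto (fun n : ℕ => n - (n - 1) / 2) atTop atTop :=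
    tendsto_atTop_mono (fun n => by omega) hr'
  have hle : ∀ᶠ n : ℕ in atTop, (n - 1) / 2 + 1 ≤ n :=
    (eventually_ge_atTop 1).mono fun n hn => by omega
  have h := (((tendsto_hexGreen_bulk (m := 0) hl' hr' (hle.mono fun n hn => ⟨rfl, hn⟩)).sub
    ((tendsto_hexGreen_bulk (m := 1) hl hr' (hle.mono fun n hn => ⟨rfl, hn⟩)).const_mul 2)).add
      (tendsto_hexGreen_bulk (m := 0) hl hr (hle.mono fun n hn => ⟨rfl, by omega⟩))).const_add 1
  convert h.congr' ?_ using 2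
  · have h₂ : √2 ^ 2 = 2 := Real.sq_sqrt (by norm_num)
    have h₀ : √2 ≠ 0 := by positivity
    rw [pow_zero, pow_one, hexAlpha]
    field_simp
    linear_combination (-4) * h₂
  · filter_upwards [hle] with n hn
    rw [hexRes_p_p hn (by omega), min_eq_right (Nat.le_succ _)]
    push_cast
    ring

theorem tendsto_hexRes_middle_p_q :
    Tendsto (fun n : ℕ => hexRes n (hexP n (n / 2)) (hexQ n (n / 2))) atTop (𝓝 (√2 / 2)) := by
  have hl : Tendsto (fun n : ℕ => n / 2) atTop atTop :=
    tendsto_atTop_atTop.2 fun b => ⟨2 * b, fun n hn => by omega⟩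
  have hr : Tendsto (fun n : ℕ => n - n / 2) atTop atTop :=
    tendsto_atTop_mono (fun n => by omega) hl
  have h := (tendsto_hexGreen_bulk (m := 0) hl hr
    (Eventually.of_forall fun n => ⟨rfl, by omega⟩)).const_mul 4
  convert h.congr fun n => ?_ using 2
  · have h₂ : √2 ^ 2 = 2 := Real.sq_sqrt (by norm_num)
    have h₀ : √2 ≠ 0 := by positivity
    rw [pow_zero]
    field_simp
    linear_combination h₂
  · rw [hexRes_comm, hexRes_q_p (by omega) (by omega), min_self]
    ring

theorem theorem3p6 :
    (∀ i j : ℕ, j ≤ i →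
      Tendsto (fun n : ℕ => hexRes n (hexP n i) (hexP n j)) atTop
        (𝓝 ((i : ℝ) - (j : ℝ) + (1 - hexAlpha ^ (i - j)) *
          (2 - hexAlpha ^ (i + j + 1) + hexAlpha ^ (2 * j + 1)) / (4 * √2))) ∧
      Tendsto (fun n : ℕ => hexRes n (hexP n j) (hexP n i)) atTop
        (𝓝 ((i : ℝ) - (j : ℝ) + (1 - hexAlpha ^ (i - j)) *
          (2 - hexAlpha ^ (i + j + 1) + hexAlpha ^ (2 * j + 1)) / (4 * √2))) ∧
      Tendsto (fun n : ℕ => hexRes n (hexQ n i) (hexP n j)) atTop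
        (𝓝 ((i : ℝ) - (j : ℝ) + (1 + hexAlpha ^ (i - j)) *
          (2 + hexAlpha ^ (i + j + 1) + hexAlpha ^ (2 * j + 1)) / (4 * √2))) ∧
      Tendsto (fun n : ℕ => hexRes n (hexQ n j) (hexP n i)) atTop
        (𝓝 ((i : ℝ) - (j : ℝ) + (1 + hexAlpha ^ (i - j)) *
          (2 + hexAlpha ^ (i + j + 1) + hexAlpha ^ (2 * j + 1)) / (4 * √2)))) ∧
    (Tendsto (fun n : ℕ => (1 / (n : ℝ)) * hexRes n (hexP n n) (hexP n 0)) atTop (𝓝 1) ∧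
      Tendsto (fun n : ℕ => (1 / (n : ℝ)) * hexRes n (hexQ n n) (hexP n 0)) atTop (𝓝 1)) ∧
    (Tendsto (fun n : ℕ => hexRes (n + 1) (hexP (n + 1) (n + 1)) (hexP (n + 1) 0) -
        hexRes n (hexP n n) (hexP n 0)) atTop (𝓝 1) ∧
      Tendsto (fun n : ℕ => hexRes (n + 1) (hexQ (n + 1) (n + 1)) (hexP (n + 1) 0) -
        hexRes n (hexQ n n) (hexP n 0)) atTop (𝓝 1)) ∧
    (Tendsto (fun n : ℕ => hexRes n (hexP n ((n - 1) / 2 + 1)) (hexP n ((n - 1) / 2))) atTop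
        (𝓝 (2 - √2 / 2)) ∧
      Tendsto (fun n : ℕ => hexRes n (hexP n (n / 2)) (hexQ n (n / 2))) atTop
        (𝓝 (√2 / 2))) := by
  refine ⟨fun i j hj => ⟨tendsto_hexRes_p_p hj, ?_, tendsto_hexRes_q_p hj⟩,
    ⟨tendsto_one_div_mul_of_tendsto_sub exists_tendsto_hexRes_p_p_sub,
      tendsto_one_div_mul_of_tendsto_sub exists_tendsto_hexRes_q_p_sub⟩,
    ⟨tendsto_succ_sub_of_tendsto_sub exists_tendsto_hexRes_p_p_sub,
      tendsto_succ_sub_of_tendsto_sub exists_tendsto_hexRes_q_p_sub⟩,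
    tendsto_hexRes_middle_p_p, tendsto_hexRes_middle_p_q⟩
  simp only [hexRes_comm _ (hexP _ j)]
  exact tendsto_hexRes_p_p hj
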